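/- Let $X$ be a $T_0$ topological space with a countable basis of open sets. In the Choquet game $\mathrm{Ch}(X)$ two players, Empty and Nonempty, play $\omega$ rounds. In round $i$, Empty picks a pair $(x_i,U_i)$ with $U_i$ open, $x_i\in U_i$ and, if $i\ge 1$, $U_i\subseteq V_{i-1}$; then Nonempty picks an open set $V_i$ with $x_i\in V_i\subseteq U_i$. Nonempty wins the play if $\bigcap_{i\in\mathbb N}V_i\neq\emptyset$. A strategy for Nonempty is a function assigning to each partial play ending with a move of Empty a legal next move of Nonempty. It is winning if Nonempty wins every play in which he follows it. A winning strategy is convergent if, in every such play, the sets $V_i$ ($i\in\mathbb N$) form a basis of neighborhoods of some $x\in\bigcap_{i\in\mathbb N}V_i$, and it is stationary if the move it returns depends only on the last move $(x_i,U_i)$ of Empty. A quasi-metric on $X$ is a function $d:X\times X\to[0,+\infty)$ such that, for all $x,y,z\in X$, $x=y\Leftrightarrow d(x,y)=d(y,x)=0$ and $d(x,z)\le d(x,y)+d(y,z)$; its topology is generated by the open balls $\{y\mid d(x,y)<r\}$, $x\in X$, $r>0$. It is complete if every sequence $(x_n)_{n\in\mathbb N}$ in $X$ with $\lim_{n\to\infty}\sup_{p\ge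 n}d(x_n,x_p)=0$ converges with respect to the metric $\widehat d(x,y)=\max\{d(x,y),d(y,x)\}$. The space $X$ is quasi-Polish if it has a countable basis and its topology is the topology of some complete quasi-metric on $X$. The following three conditions are equivalent. 1. Nonempty has a convergent winning strategy in $\mathrm{Ch}(X)$. 2. Nonempty has a stationary convergent winning strategy in $\mathrm{Ch}(X)$. 3. $X$ is quasi-Polish. -/

import Mathlib

open Set Filter Topology

/-! ### Quasi-metrics and quasi-Polish spaces -/

/-- A quasi-metric: a metric without the symmetry axiom. -/
structure QuasiMetric (X : Type*) where
  dist : X → X → ℝ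
  dist_nonneg : ∀ x y, 0 ≤ dist x y
  eq_iff : ∀ x y, x = y ↔ dist x y = 0 ∧ dist y x = 0
  triangle : ∀ x y z, dist x z ≤ dist x y + dist y z

namespace QuasiMetric

variable {X : Type*}

/-- The open ball `{y | d(x, y) < r}`. -/
def ball (d : QuasiMetric X) (x : X) (r : ℝ) : Set X := {y | d.dist x y < r}

/-- The topology generated by the open balls. -/
@[reducible] def topology (d : QuasiMetric X) : TopologicalSpace X :=
  TopologicalSpace.generateFrom {s | ∃ x : X, ∃ r : ℝ, 0 < r ∧ s = d.ball x r}

/-- `u` is Cauchy: `sup_{p ≥ n} d(u n, u p)` tends to `0` as `n → ∞`. -/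
def IsCauchy (d : QuasiMetric X) (u : ℕ → X) : Prop :=
  ∀ ε : ℝ, 0 < ε → ∃ N : ℕ, ∀ n, N ≤ n → ∀ p, n ≤ p → d.dist (u n) (u p) < ε

/-- The symmetrized metric `max (d(x, y)) (d(y, x))`. -/
def symmDist (d : QuasiMetric X) (x y : X) : ℝ := max (d.dist x y) (d.dist y x)

/-- Every Cauchy sequence converges with respect to the symmetrized metric. -/
def IsComplete (d : QuasiMetric X) : Prop :=
  ∀ u : ℕ → X, d.IsCauchy u → ∃ x : X, Tendsto (fun n => d.symmDist (u n) x) atTop (𝓝 0)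

end QuasiMetric

/-- A quasi-Polish space: a space with a countable basis whose topology is the one associated
with some complete quasi-metric. -/
def IsQuasiPolish (X : Type*) [t : TopologicalSpace X] : Prop :=
  SecondCountableTopology X ∧ ∃ d : QuasiMetric X, d.IsComplete ∧ t = d.topology

/-! ### The Choquet game -/

namespace ChoquetGame

open TopologicalSpace (Opens)

/-- A move of Empty: an open set together with a point of it. -/
structure EmptyMove (X : Type*) [TopologicalSpace X] where
  point : X
  nbhd : Opens X
  mem : point ∈ nbhd

variable {X : Type*} [TopologicalSpace X]

/-- `v` is a legal answer of Nonempty to the move `m` of Empty. -/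
def LegalReply (m : EmptyMove X) (v : Opens X) : Prop := m.point ∈ v ∧ v ≤ m.nbhd

/-- The sequence `e 0, v 0, e 1, v 1, …` of moves of Empty and Nonempty is a legal play. -/
def IsPlay (e : ℕ → EmptyMove X) (v : ℕ → Opens X) : Prop :=
  ∀ i, LegalReply (e i) (v i) ∧ (e (i + 1)).nbhd ≤ v i

/-- The finite sequence `e 0, v 0, …, e (n - 1), v (n - 1), e n` is a legal partial play,
ending with Empty's move of round `n`. -/
def IsPartialPlay {n : ℕ} (e : Fin (n + 1) → EmptyMove X) (v : Fin n → Opens X) : Prop :=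
  ∀ i : Fin n, LegalReply (e i.castSucc) (v i) ∧ (e i.succ).nbhd ≤ v i

variable (X) in
/-- A strategy for Nonempty: a function taking partial plays that end with a move of Empty and
returning a legal move of Nonempty. (Its values on illegal sequences of moves are irrelevant.) -/
structure Strategy where
  move : (n : ℕ) → (Fin (n + 1) → EmptyMove X) → (Fin n → Opens X) → Opens X
  legal : ∀ (n : ℕ) (e : Fin (n + 1) → EmptyMove X) (v : Fin n → Opens X),
    IsPartialPlay e v → LegalReply (e (Fin.last n)) (move n e v)

namespace Strategy

/-- In the play `e 0, v 0, e 1, v 1, …` Nonempty follows the strategy `σ`. -/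
def Follows (σ : Strategy X) (e : ℕ → EmptyMove X) (v : ℕ → Opens X) : Prop :=
  ∀ n, v n = σ.move n (fun i => e i) (fun i => v i)

/-- Nonempty wins every play in which he follows `σ`. -/
def IsWinning (σ : Strategy X) : Prop :=
  ∀ (e : ℕ → EmptyMove X) (v : ℕ → Opens X), IsPlay e v → σ.Follows e v →
    (⋂ i, (v i : Set X)).Nonempty

/-- In every play in which Nonempty follows `σ`, his moves form a basis of neighborhoods of
some point of their intersection. -/
def IsConvergent (σ : Strategy X) : Prop :=
  ∀ (e : ℕ → EmptyMove X) (v : ℕ → Opens X), IsPlay e v → σ.Follows e v →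
    ∃ x ∈ ⋂ i, (v i : Set X), (𝓝 x).HasBasis (fun _ : ℕ => True) (fun i => (v i : Set X))

/-- `σ` depends only on the last move of the opponent. -/
def IsStationary (σ : Strategy X) : Prop :=
  ∀ (n m : ℕ) (e : Fin (n + 1) → EmptyMove X) (v : Fin n → Opens X)
    (e' : Fin (m + 1) → EmptyMove X) (v' : Fin m → Opens X),
    IsPartialPlay e v → IsPartialPlay e' v' → e (Fin.last n) = e' (Fin.last m) →
      σ.move n e v = σ.move m e' v'

end Strategy

end ChoquetGame

/-! From a complete quasi-metric to a stationary strategy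
(`exists_stationary_convergent_of_complete`): Nonempty answers with basic open sets, each repairing
the first unmet requirement of the form "a basic set containing the point must contain the current
open set with room to spare". This requires no memory, since a requirement once met stays met, and
`eventually_good_of_first_failure` shows that each is eventually met. The answers then shrink like
balls whose centers form a Cauchy sequence.

From a convergent strategy to a quasi-metric (`isQuasiPolish_of_convergent`): for countably many
index sets `J n`, let the level of a point be the least index in `J n` of a basic set containing it,
and let `d(x, y)` be the sum of `2⁻ⁿ` over the `n` at which the level of `x` is smaller than that of
`y`. Along a Cauchy sequence every level stabilizes. Hence, whenever the sets indexed by some `J n`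
eventually cover the sequence, one of them contains almost all of it. Applied to covers by
Nonempty's answers in a countable tree of positions, this produces a play whose answers all contain
almost all of the sequence and whose moves enter every basic set that does. Convergence of the
strategy gives the limit. -/

theorem exists_basis_sequence (X : Type*) [TopologicalSpace X] [SecondCountableTopology X] :
    ∃ B : ℕ → Set X, TopologicalSpace.IsTopologicalBasis (range B) := by
  obtain ⟨b, hbc, -, hb⟩ := TopologicalSpace.exists_countable_basis X
  -- Adding `∅` makes the family nonempty, hence the range of a sequence, even when `X` is empty.
  obtain ⟨B, hB⟩ := (hbc.insert ∅).exists_eq_range (insert_nonempty _ _)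
  exact ⟨B, hB ▸ hb.insert_empty⟩

namespace QuasiMetric

variable {X : Type*}

theorem dist_self (d : QuasiMetric X) (x : X) : d.dist x x = 0 := ((d.eq_iff x x).1 rfl).1

theorem mem_ball_self (d : QuasiMetric X) (x : X) {r : ℝ} (hr : 0 < r) : x ∈ d.ball x r := by
  simpa [ball, d.dist_self] using hr

theorem ball_subset_ball (d : QuasiMetric X) {x y : X} {r s : ℝ} (h : d.dist x y + s ≤ r) :
    d.ball y s ⊆ d.ball x r := by
  intro z hz
  have := d.triangle x y z
  simp only [ball, mem_ofPred_eq] at hz ⊢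
  linarith

theorem isOpen_ball (d : QuasiMetric X) (x : X) {r : ℝ} (hr : 0 < r) :
    IsOpen[d.topology] (d.ball x r) :=
  TopologicalSpace.isOpen_generateFrom_of_mem ⟨x, r, hr, rfl⟩

theorem isOpen_iff (d : QuasiMetric X) {U : Set X} :
    IsOpen[d.topology] U ↔ ∀ x ∈ U, ∃ r, 0 < r ∧ d.ball x r ⊆ U := by
  constructor
  · intro h
    induction h with
    | basic s hs =>
      obtain ⟨x, r, -, rfl⟩ := hs
      intro y hy
      exact ⟨r - d.dist x y, sub_pos.2 hy, d.ball_subset_ball (by linarith)⟩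
    | univ => exact fun x _ => ⟨1, one_pos, subset_univ _⟩
    | inter s t _ _ hs ht =>
      rintro x ⟨hxs, hxt⟩
      obtain ⟨r, hr, hrs⟩ := hs x hxs
      obtain ⟨r', hr', hrt⟩ := ht x hxt
      refine ⟨min r r', lt_min hr hr', fun y hy => ?_⟩
      simp only [ball, mem_ofPred_eq, lt_min_iff] at hy
      exact ⟨hrs hy.1, hrt hy.2⟩
    | sUnion S _ ih =>
      rintro x ⟨s, hs, hxs⟩
      obtain ⟨r, hr, hrs⟩ := ih s hs x hxs
      exact ⟨r, hr, hrs.trans (subset_sUnion_of_mem hs)⟩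
  · intro h
    let _ := d.topology
    refine isOpen_iff_forall_mem_open.2 fun x hx => ?_
    obtain ⟨r, hr, hrU⟩ := h x hx
    exact ⟨_, hrU, d.isOpen_ball x hr, d.mem_ball_self x hr⟩

end QuasiMetric

/-! ### A stationary convergent strategy from a complete quasi-metric -/

namespace ChoquetGame

open TopologicalSpace (Opens)

variable {X : Type*} [TopologicalSpace X]

theorem IsPlay.antitone {e : ℕ → EmptyMove X} {v : ℕ → Opens X} (h : IsPlay e v) : Antitone v :=
  antitone_nat_of_succ_le fun i => (h (i + 1)).1.2.trans (h i).2

/-- The strategy that applies a fixed reply to the last move of the opponent. -/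
def Strategy.ofReply (f : EmptyMove X → Opens X) (hf : ∀ m, LegalReply m (f m)) : Strategy X where
  move n e _ := f (e (Fin.last n))
  legal _ _ _ _ := hf _

/-- If `good j` is a downward closed property of open sets for every `j`, and the replies `v i`
satisfy the first property that is relevant for the move `e i` and that fails for it, then
eventually no relevant property fails. -/
theorem eventually_good_of_first_failure {e : ℕ → EmptyMove X} {v : ℕ → Opens X} (h : IsPlay e v)
    (rel : ℕ → X → Prop) (good : ℕ → Opens X → Prop)
    (hgood : ∀ j U V, U ≤ V → good j V → good j U)
    (hv : ∀ i j, rel j (e i).point → ¬ good j (e i).nbhd →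
      (∀ l < j, rel l (e i).point → good l (e i).nbhd) → good j (v i)) (j : ℕ) :
    ∀ᶠ i in atTop, rel j (e i).point → good j (e i).nbhd := by
  induction j using Nat.strong_induction_on with
  | _ j ih =>
    obtain ⟨N, hN⟩ := eventually_atTop.1
      ((eventually_all_finite (Set.finite_lt_nat j)).2 fun l hl => ih l hl)
    -- From round `N` on, no index below `j` fails. A failure of `j` is then the first one, so the
    -- answer repairs it, permanently because the open sets decrease.
    by_cases hbad : ∃ i ≥ N, rel j (e i).point ∧ ¬ good j (e i).nbhd
    · obtain ⟨i, hi, hrel, hng⟩ := hbad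
      filter_upwards [eventually_gt_atTop i] with i' hi' _
      obtain ⟨k, rfl⟩ : ∃ k, i' = k + 1 := ⟨i' - 1, by omega⟩
      exact hgood _ _ _ ((h k).2.trans (h.antitone (by omega)))
        (hv i j hrel hng fun l hl => hN i hi l hl)
    · push Not at hbad
      filter_upwards [eventually_ge_atTop N] with i hi using hbad i hi

theorem exists_stationary_convergent_of_complete [SecondCountableTopology X] (d : QuasiMetric X)
    (hd : d.IsComplete)
    (hopen : ∀ U : Set X, IsOpen U ↔ ∀ x ∈ U, ∃ r, 0 < r ∧ d.ball x r ⊆ U) :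
    ∃ σ : Strategy X, σ.IsWinning ∧ σ.IsConvergent ∧ σ.IsStationary := by
  obtain ⟨B, hB⟩ := exists_basis_sequence X
  have hBo : ∀ k, IsOpen (B k) := fun k => hB.isOpen (mem_range_self k)
  let rel : ℕ → X → Prop := fun j x => x ∈ B j.unpair.1
  -- The index `j` codes a basic set and a bound on the radius. The center `z` is quantified, not
  -- tied to Empty's point, so that the property passes to smaller open sets.
  let good : ℕ → Opens X → Prop := fun j U => ∃ z ∈ B j.unpair.1, ∃ r : ℝ, 0 < r ∧
    r < (1 / 2) ^ j.unpair.2 ∧ d.ball z (2 * r) ⊆ B j.unpair.1 ∧ (U : Set X) ⊆ d.ball z r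
  have hgood : ∀ j U V, U ≤ V → good j V → good j U := by
    rintro j U V hUV ⟨z, hz, r, hr, hrj, hs, hV⟩
    exact ⟨z, hz, r, hr, hrj, hs, subset_trans hUV hV⟩
  have hreply : ∀ m : EmptyMove X, ∃ V : Opens X, LegalReply m V ∧ (V : Set X) ∈ range B ∧
      ∀ j, rel j m.point → ¬ good j m.nbhd →
        (∀ l < j, rel l m.point → good l m.nbhd) → good j V := by
    intro m
    by_cases hbad : ∃ j, rel j m.point ∧ ¬ good j m.nbhd ∧
        ∀ l < j, rel l m.point → good l m.nbhd
    · obtain ⟨j, hrel, hng, hmin⟩ := hbad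
      obtain ⟨s, hs, hsB⟩ := (hopen _).1 (hBo j.unpair.1) m.point hrel
      have hp : (0 : ℝ) < (1 / 2) ^ j.unpair.2 := by positivity
      obtain ⟨r, hr, hrm⟩ : ∃ r : ℝ, 0 < r ∧ r < min (s / 2) ((1 / 2) ^ j.unpair.2) :=
        exists_between (lt_min (half_pos hs) hp)
      obtain ⟨hrs, hrj⟩ := lt_min_iff.1 hrm
      have hball : IsOpen (d.ball m.point r) :=
        (hopen _).2 fun y hy => ⟨r - d.dist m.point y, sub_pos.2 hy,
          d.ball_subset_ball (by linarith)⟩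
      obtain ⟨V, hVB, hxV, hV⟩ := hB.exists_subset_of_mem_open
        (⟨m.mem, d.mem_ball_self _ hr⟩ : m.point ∈ (m.nbhd : Set X) ∩ d.ball m.point r)
        (m.nbhd.isOpen.inter hball)
      refine ⟨⟨V, hB.isOpen hVB⟩, ⟨hxV, fun y hy => (hV hy).1⟩, hVB, fun j' hrel' hng' hmin' => ?_⟩
      obtain rfl : j' = j := by
        rcases lt_trichotomy j' j with h | h | h
        · exact absurd (hmin _ h hrel') hng'
        · exact h
        · exact absurd (hmin' _ h hrel) hng
      exact ⟨m.point, hrel, r, hr, hrj,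
        (d.ball_subset_ball (by rw [d.dist_self]; linarith)).trans hsB, fun y hy => (hV hy).2⟩
    · obtain ⟨V, hVB, hxV, hV⟩ := hB.exists_subset_of_mem_open m.mem m.nbhd.isOpen
      exact ⟨⟨V, hB.isOpen hVB⟩, ⟨hxV, hV⟩, hVB,
        fun j h1 h2 h3 => absurd ⟨j, h1, h2, h3⟩ hbad⟩
  choose f hf hfB hfgood using hreply
  have hconv : (Strategy.ofReply f hf).IsConvergent := by
    intro e v hplay hfol
    have hv : ∀ i, v i = f (e i) := hfol
    have hgoodev := eventually_good_of_first_failure hplay rel good hgood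
      fun i j h1 h2 h3 => hv i ▸ hfgood (e i) j h1 h2 h3
    -- Since `v i` is itself basic and contains all later points, the requirement coded by it and
    -- `n` is relevant from then on and is eventually met.
    have hstep : ∀ i n : ℕ, ∃ i' > i, ∃ z ∈ v i, ∃ r : ℝ, 0 < r ∧ r < (1 / 2) ^ n ∧
        d.ball z (2 * r) ⊆ v i ∧ (v i' : Set X) ⊆ d.ball z r := by
      intro i n
      obtain ⟨k, hk⟩ : ∃ k, B k = v i := hv i ▸ hfB (e i)
      obtain ⟨i', hi', hlt⟩ :=
        ((hgoodev (Nat.pair k n)).and (eventually_gt_atTop i)).exists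
      have hmem : (e i').point ∈ (v i : Set X) := hplay.antitone hlt.le (hplay i').1.1
      obtain ⟨z, hz, r, hr, hrn, hball, hU⟩ := hi' (by simpa [rel, hk] using hmem)
      simp only [Nat.unpair_pair, hk] at hz hrn hball
      exact ⟨i', hlt, z, hz, r, hr, hrn, hball, subset_trans (hplay i').1.2 hU⟩
    choose next hnext z hz r hr hrn hball hsub using hstep
    let i : ℕ → ℕ := fun n => Nat.rec 0 (fun n a => next a n) n
    have hisucc : ∀ n, i (n + 1) = next (i n) n := fun _ => rfl
    have himono : StrictMono i := strictMono_nat_of_lt_succ fun n => hnext _ _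
    let u : ℕ → X := fun n => z (i n) n
    have hlt : ∀ n p, n < p → d.dist (u n) (u p) < r (i n) n := fun n p hnp =>
      hsub (i n) n (hplay.antitone (himono.monotone hnp) (hz (i p) p))
    have hle : ∀ n p, n ≤ p → d.dist (u n) (u p) ≤ r (i n) n := by
      intro n p hnp
      rcases hnp.eq_or_lt with rfl | h
      · exact (d.dist_self _).trans_le (hr _ _).le
      · exact (hlt n p h).le
    have hpow : Tendsto (fun n : ℕ => (1 / 2 : ℝ) ^ n) atTop (𝓝 0) :=
      tendsto_pow_atTop_nhds_zero_of_lt_one (by norm_num) (by norm_num)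
    obtain ⟨x, hx⟩ := hd u fun ε hε => by
      obtain ⟨N, hN⟩ := eventually_atTop.1 (hpow.eventually_lt_const hε)
      exact ⟨N, fun n hn p hp => (hle n p hp).trans_lt ((hrn _ _).trans (hN n hn))⟩
    have hsymm : ∀ ε > 0, ∀ᶠ n in atTop, d.dist (u n) x < ε ∧ d.dist x (u n) < ε := fun ε hε => by
      filter_upwards [hx.eventually_lt_const hε] with n hn using max_lt_iff.1 hn
    have hxr : ∀ n, d.dist (u n) x ≤ r (i n) n := by
      intro n
      refine le_of_forall_pos_le_add fun ε hε => ?_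
      obtain ⟨p, hp, hnp⟩ := ((hsymm ε hε).and (eventually_ge_atTop n)).exists
      have := d.triangle (u n) (u p) x
      linarith [hle n p hnp, hp.1]
    -- The limit only satisfies the weak inequality `d(u j, x) ≤ r`; the doubled radius in `good`
    -- absorbs this.
    have hxv : ∀ j, x ∈ (v j : Set X) := fun j => by
      refine hplay.antitone (himono.id_le j) (hball (i j) j ?_)
      have := hr (i j) j
      exact (hxr j).trans_lt (by linarith)
    refine ⟨x, mem_iInter.2 hxv, ⟨fun W => ⟨fun hW => ?_, ?_⟩⟩⟩
    · obtain ⟨W', hW', hW'o, hxW'⟩ := mem_nhds_iff.1 hW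
      obtain ⟨ε, hε, hεW⟩ := (hopen W').1 hW'o x hxW'
      obtain ⟨n, hn, hn'⟩ :=
        ((hsymm _ (half_pos hε)).and (hpow.eventually_lt_const (half_pos hε))).exists
      refine ⟨i (n + 1), trivial, (hsub (i n) n).trans
        ((d.ball_subset_ball ?_).trans (hεW.trans hW'))⟩
      have h2 := hn.2
      have h3 := hrn (i n) n
      simp only [u] at h2
      linarith
    · rintro ⟨j, -, hj⟩
      exact mem_of_superset ((v j).isOpen.mem_nhds (hxv j)) hj
  refine ⟨Strategy.ofReply f hf, fun e v hp hfol => ?_, hconv, fun n m e v e' v' _ _ h => ?_⟩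
  · obtain ⟨x, hx, -⟩ := hconv e v hp hfol
    exact ⟨x, hx⟩
  · exact congrArg f h

end ChoquetGame

/-! ### Levels of points with respect to a sequence of sets -/

section Level

variable {X : Type*}

/-- The least index in `J` of a set of the family `B` that contains `x`. -/
noncomputable def level (B : ℕ → Set X) (J : Set ℕ) (x : X) : ℕ∞ :=
  sInf ((fun j : ℕ => (j : ℕ∞)) '' {j ∈ J | x ∈ B j})

variable {B : ℕ → Set X} {J : Set ℕ} {x : X}

theorem level_le {j : ℕ} (hj : j ∈ J) (hx : x ∈ B j) : level B J x ≤ j :=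
  sInf_le ⟨j, ⟨hj, hx⟩, rfl⟩

theorem mem_of_level_eq {j : ℕ} (h : level B J x = j) : j ∈ J ∧ x ∈ B j := by
  have hne : ((fun j : ℕ => (j : ℕ∞)) '' {j ∈ J | x ∈ B j}).Nonempty := by
    by_contra hempty
    rw [level, not_nonempty_iff_eq_empty.1 hempty, sInf_empty] at h
    exact ENat.top_ne_natCast j h
  obtain ⟨k, hk, hkj⟩ := csInf_mem hne
  change (k : ℕ∞) = level B J x at hkj
  rw [h, Nat.cast_inj] at hkj
  exact hkj ▸ hk

/-- Through singleton index sets, the levels determine the basis, hence the points of a T₀ space. -/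
theorem level_singleton_lt_top {k : ℕ} : level B {k} x < ⊤ ↔ x ∈ B k := by
  constructor
  · intro h
    obtain ⟨j, hj⟩ := ENat.ne_top_iff_exists.1 h.ne
    obtain ⟨hjk, hx⟩ := mem_of_level_eq hj.symm
    exact mem_singleton_iff.1 hjk ▸ hx
  · exact fun h => (level_le (mem_singleton k) h).trans_lt (ENat.natCast_lt_top k)

/-- This semicontinuity makes the balls of the level quasi-metric open in the given topology. -/
theorem eventually_level_le [TopologicalSpace X] (hB : ∀ k, IsOpen (B k)) (J : Set ℕ) (x : X) :
    ∀ᶠ y in 𝓝 x, level B J y ≤ level B J x := by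
  rcases eq_or_ne (level B J x) ⊤ with h | h
  · simp [h]
  · obtain ⟨j, hj⟩ := ENat.ne_top_iff_exists.1 h
    obtain ⟨hjJ, hxj⟩ := mem_of_level_eq hj.symm
    filter_upwards [(hB j).mem_nhds hxj] with y hy
    exact hj ▸ level_le hjJ hy

/-- If the levels of a sequence are eventually constant and `x` belongs to the same sets of the
family as almost all terms of the sequence, then the levels of `x` are the limiting ones. -/
theorem level_eq_of_eventually {u : ℕ → X} (hx : ∀ k, x ∈ B k ↔ ∀ᶠ i in atTop, u i ∈ B k)
    {l : ℕ∞} (hl : ∀ᶠ i in atTop, level B J (u i) = l) : level B J x = l := by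
  apply le_antisymm
  · rcases eq_or_ne l ⊤ with rfl | h
    · exact le_top
    · obtain ⟨j, rfl⟩ := ENat.ne_top_iff_exists.1 h
      have hj : j ∈ J := by
        obtain ⟨i, hi⟩ := hl.exists
        exact (mem_of_level_eq hi).1
      exact level_le hj ((hx j).2 (hl.mono fun i hi => (mem_of_level_eq hi).2))
  · rcases eq_or_ne (level B J x) ⊤ with h | h
    · exact h ▸ le_top
    · obtain ⟨j, hj⟩ := ENat.ne_top_iff_exists.1 h
      obtain ⟨hjJ, hxj⟩ := mem_of_level_eq hj.symm
      obtain ⟨i, hi, hi'⟩ := (hl.and ((hx j).1 hxj)).exists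
      rw [← hi, ← hj]
      exact level_le hjJ hi'

end Level

theorem eventually_const_of_eventually_antitone {α : Type*} [LinearOrder α] [WellFoundedLT α]
    {f : ℕ → α} {N : ℕ} (h : ∀ n, N ≤ n → ∀ p, n ≤ p → f p ≤ f n) :
    ∃ l, ∀ᶠ i in atTop, f i = l := by
  obtain ⟨-, ⟨n, hn, rfl⟩, hmin⟩ :=
    (wellFounded_lt (α := α)).has_min (f '' Ici N) ⟨f N, N, le_refl N, rfl⟩
  refine ⟨f n, ?_⟩
  filter_upwards [eventually_ge_atTop n] with p hp
  exact (h n hn p hp).antisymm (not_lt.1 (hmin _ ⟨p, le_trans hn hp, rfl⟩))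

/-! ### The quasi-metric defined by levels -/

section LevelQuasiMetric

variable {X : Type*} (B : ℕ → Set X) (J : ℕ → Set ℕ)

open Classical in
/-- The `n`-th term of the series defining the quasi-metric of a family of levels. -/
noncomputable def levelTerm (x y : X) (n : ℕ) : ℝ :=
  if level B (J n) x < level B (J n) y then (1 / 2) ^ n else 0

variable {B J}

theorem levelTerm_nonneg (x y : X) (n : ℕ) : 0 ≤ levelTerm B J x y n := by
  unfold levelTerm; split_ifs <;> positivity

theorem levelTerm_le (x y : X) (n : ℕ) : levelTerm B J x y n ≤ (1 / 2) ^ n := by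
  unfold levelTerm; split_ifs
  · exact le_rfl
  · positivity

theorem levelTerm_eq_zero {x y : X} {n : ℕ} :
    levelTerm B J x y n = 0 ↔ level B (J n) y ≤ level B (J n) x := by
  unfold levelTerm; split_ifs with h
  · simp [h]
  · simpa using h

theorem levelTerm_triangle (x y z : X) (n : ℕ) :
    levelTerm B J x z n ≤ levelTerm B J x y n + levelTerm B J y z n := by
  have h1 := levelTerm_nonneg (B := B) (J := J) x y n
  have h2 := levelTerm_nonneg (B := B) (J := J) y z n
  have hp : (0 : ℝ) < (1 / 2) ^ n := by positivity
  unfold levelTerm at *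
  split_ifs with h3 h4 h5 h5 <;> try linarith
  · exact absurd h3 (not_lt.2 ((not_lt.1 h5).trans (not_lt.1 h4)))

theorem summable_levelTerm (x y : X) : Summable (levelTerm B J x y) :=
  Summable.of_nonneg_of_le (levelTerm_nonneg x y) (levelTerm_le x y) summable_geometric_two

theorem levelTerm_le_tsum (x y : X) (n : ℕ) : levelTerm B J x y n ≤ ∑' k, levelTerm B J x y k :=
  (summable_levelTerm x y).le_tsum n fun _ _ => levelTerm_nonneg _ _ _

theorem level_le_of_tsum_lt {x y : X} {n : ℕ} (h : ∑' k, levelTerm B J x y k < (1 / 2) ^ n) :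
    level B (J n) y ≤ level B (J n) x := by
  by_contra hlt
  have := levelTerm_le_tsum (B := B) (J := J) x y n
  rw [levelTerm, if_pos (not_le.1 hlt)] at this
  linarith

theorem tendsto_tsum_levelTerm {β : Type*} {F : Filter β} {f g : β → X}
    (h : ∀ n, ∀ᶠ b in F, level B (J n) (g b) ≤ level B (J n) (f b)) :
    Tendsto (fun b => ∑' n, levelTerm B J (f b) (g b) n) F (𝓝 0) := by
  have := tendsto_tsum_of_dominated_convergence (𝓕 := F)
    (f := fun b n => levelTerm B J (f b) (g b) n) (g := fun _ => 0) summable_geometric_two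
    (fun n => tendsto_const_nhds.congr' ((h n).mono fun b hb => (levelTerm_eq_zero.2 hb).symm))
    (Eventually.of_forall fun b n => by
      rw [Real.norm_of_nonneg (levelTerm_nonneg _ _ _)]; exact levelTerm_le _ _ _)
  simpa using this

/-- The quasi-metric of a family of levels. -/
noncomputable def levelQuasiMetric
    (hsep : ∀ x y : X, (∀ n, level B (J n) x = level B (J n) y) → x = y) : QuasiMetric X where
  dist x y := ∑' n, levelTerm B J x y n
  dist_nonneg x y := tsum_nonneg (levelTerm_nonneg x y)
  eq_iff x y := by
    have key : ∀ x y : X, ∑' n, levelTerm B J x y n = 0 →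
        ∀ n, level B (J n) y ≤ level B (J n) x := fun x y h n =>
      levelTerm_eq_zero.1 (le_antisymm (h ▸ levelTerm_le_tsum x y n) (levelTerm_nonneg x y n))
    constructor
    · rintro rfl
      simp [levelTerm]
    · rintro ⟨h1, h2⟩
      exact hsep x y fun n => (key y x h2 n).antisymm (key x y h1 n)
  triangle x y z := by
    rw [← (summable_levelTerm x y).tsum_add (summable_levelTerm y z)]
    exact (summable_levelTerm x z).tsum_le_tsum (levelTerm_triangle x y z)
      ((summable_levelTerm x y).add (summable_levelTerm y z))

/-- A criterion for quasi-Polishness in terms of a countable basis `B` and of countably many sets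
of indices: it suffices that each sequence along which all the levels stabilize has a limit with
the limiting levels. -/
theorem isQuasiPolish_of_levels [t : TopologicalSpace X] [T0Space X] [SecondCountableTopology X]
    (hB : TopologicalSpace.IsTopologicalBasis (range B)) (hJ : ∀ k, {k} ∈ range J)
    (hcomplete : ∀ u : ℕ → X, (∀ n, ∃ l, ∀ᶠ i in atTop, level B (J n) (u i) = l) →
      ∃ x, ∀ k, x ∈ B k ↔ ∀ᶠ i in atTop, u i ∈ B k) : IsQuasiPolish X := by
  have hBo : ∀ k, IsOpen (B k) := fun k => hB.isOpen (mem_range_self k)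
  have hsep : ∀ x y : X, (∀ n, level B (J n) x = level B (J n) y) → x = y := by
    intro x y h
    refine (hB.inseparable_iff.2 ?_).eq
    rintro _ ⟨k, rfl⟩
    obtain ⟨n, hn⟩ := hJ k
    have := h n
    rw [hn] at this
    rw [← level_singleton_lt_top, this, level_singleton_lt_top]
  refine ⟨inferInstance, levelQuasiMetric hsep, ?_, ?_⟩
  · intro u hu
    have hlev : ∀ n, ∃ l, ∀ᶠ i in atTop, level B (J n) (u i) = l := by
      intro n
      obtain ⟨N, hN⟩ := hu ((1 / 2) ^ n) (by positivity)
      exact eventually_const_of_eventually_antitone fun i hi p hp =>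
        level_le_of_tsum_lt (hN i hi p hp)
    obtain ⟨x, hx⟩ := hcomplete u hlev
    have heq : ∀ n, ∀ᶠ i in atTop, level B (J n) (u i) = level B (J n) x := by
      intro n
      obtain ⟨l, hl⟩ := hlev n
      rw [level_eq_of_eventually hx hl]
      exact hl
    refine ⟨x, ?_⟩
    have h1 := tendsto_tsum_levelTerm (g := fun _ => x) fun n => (heq n).mono fun _ h => h.ge
    have h2 := tendsto_tsum_levelTerm (f := fun _ => x) fun n => (heq n).mono fun _ h => h.le
    have hmax := h1.max h2
    rw [max_self] at hmax
    exact hmax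
  · apply le_antisymm
    · refine le_generateFrom ?_
      rintro _ ⟨x, r, -, rfl⟩
      refine isOpen_iff_mem_nhds.2 fun y hy => ?_
      have hlim := tendsto_tsum_levelTerm (f := fun _ => y) (g := id)
        fun n => eventually_level_le hBo (J n) y
      refine mem_of_superset (hlim.eventually_lt_const (sub_pos.2 hy)) ?_
      exact (levelQuasiMetric hsep).ball_subset_ball (x := x) (y := y)
        (s := r - (levelQuasiMetric hsep).dist x y) (by linarith)
    · rw [hB.eq_generateFrom]
      refine le_generateFrom ?_
      rintro _ ⟨k, rfl⟩
      refine (levelQuasiMetric hsep).isOpen_iff.2 fun x hx => ?_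
      obtain ⟨n, hn⟩ := hJ k
      -- Within this radius the level for `J n = {k}` cannot increase, so it stays finite.
      refine ⟨(1 / 2) ^ n, by positivity, fun y hy => ?_⟩
      have := level_le_of_tsum_lt hy
      rw [hn] at this
      exact level_singleton_lt_top.1 (this.trans_lt (level_singleton_lt_top.2 hx))

end LevelQuasiMetric

/-! ### Countable trees of plays, and a complete quasi-metric from a convergent strategy -/

namespace ChoquetGame

open TopologicalSpace (Opens)

variable {X : Type*} [TopologicalSpace X]

namespace Strategy

/-- The moves of Nonempty when he follows `σ` and his opponent plays `e`. -/
noncomputable def run (σ : Strategy X) (e : ℕ → EmptyMove X) (n : ℕ) : Opens X :=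
  σ.move n (fun i => e i) (fun i => run σ e i)
termination_by n
decreasing_by exact i.2

variable (σ : Strategy X)

theorem follows_run (e : ℕ → EmptyMove X) : σ.Follows e (σ.run e) := fun n => by
  rw [run]

theorem run_congr {e e' : ℕ → EmptyMove X} {n : ℕ} (h : ∀ i ≤ n, e i = e' i) :
    σ.run e n = σ.run e' n := by
  induction n using Nat.strong_induction_on with
  | _ n ih =>
    rw [run, run]
    congr 1
    · funext i
      exact h i (Nat.lt_succ_iff.1 i.2)
    · funext i
      exact ih i i.2 fun j hj => h j (hj.trans i.2.le)

/-- The open set in which the game goes on after `n` rounds. -/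
noncomputable def current (e : ℕ → EmptyMove X) : ℕ → Opens X
  | 0 => ⊤
  | n + 1 => σ.run e n

theorem current_congr {e e' : ℕ → EmptyMove X} {n : ℕ} (h : ∀ i < n, e i = e' i) :
    σ.current e n = σ.current e' n := by
  cases n with
  | zero => rfl
  | succ n => exact σ.run_congr fun i hi => h i (Nat.lt_succ_iff.2 hi)

/-- The first `n` moves of `e` are legal if Nonempty follows `σ`. -/
def LegalUpTo (e : ℕ → EmptyMove X) (n : ℕ) : Prop := ∀ i < n, (e i).nbhd ≤ σ.current e i

variable {σ}

theorem LegalUpTo.legalReply {e : ℕ → EmptyMove X} {n : ℕ} (h : σ.LegalUpTo e n) :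
    ∀ i < n, LegalReply (e i) (σ.run e i) := by
  intro i
  induction i using Nat.strong_induction_on with
  | _ i ih =>
    intro hi
    rw [run]
    exact σ.legal i (fun j => e j) (fun j => σ.run e j) fun j =>
      ⟨ih j j.2 (j.2.trans hi), h (j + 1) (lt_of_le_of_lt j.2 hi)⟩

theorem isPlay_run {e : ℕ → EmptyMove X} (h : ∀ n, σ.LegalUpTo e n) : IsPlay e (σ.run e) :=
  fun i => ⟨(h (i + 1)).legalReply i i.lt_succ_self, h (i + 2) (i + 1) (by omega)⟩

variable (σ)

theorem current_update (e : ℕ → EmptyMove X) (n : ℕ) (m : EmptyMove X) {k : ℕ} (hk : k ≤ n) :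
    σ.current (Function.update e n m) k = σ.current e k :=
  σ.current_congr fun i hi => Function.update_of_ne (by omega) _ _

variable {σ}

theorem LegalUpTo.update {e : ℕ → EmptyMove X} {n : ℕ} (h : σ.LegalUpTo e n) {m : EmptyMove X}
    (hm : m.nbhd ≤ σ.current e n) : σ.LegalUpTo (Function.update e n m) (n + 1) := by
  intro i hi
  rw [σ.current_update e n m (Nat.lt_succ_iff.1 hi)]
  rcases (Nat.lt_succ_iff.1 hi).eq_or_lt with rfl | hlt
  · simpa using hm
  · rw [Function.update_of_ne hlt.ne]
    exact h i hlt

/-- Countably many moves of Empty with a given open set suffice for the answers of Nonempty to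
cover that set. -/
theorem LegalUpTo.exists_countable_moves [SecondCountableTopology X] {e : ℕ → EmptyMove X} {n : ℕ}
    (h : σ.LegalUpTo e n) {U : Opens X} (hU : U ≤ σ.current e n) :
    ∃ M : Set (EmptyMove X), M.Countable ∧ (∀ m ∈ M, m.nbhd = U) ∧
      ∀ x ∈ U, ∃ m ∈ M, x ∈ σ.current (Function.update e n m) (n + 1) := by
  let mv : U → EmptyMove X := fun y => ⟨y, U, y.2⟩
  -- The answer to `(y, U)` contains `y`, so these answers cover `U`; second countability gives a
  -- countable subcover.
  obtain ⟨T, hT, hTU⟩ := TopologicalSpace.isOpen_iUnion_countable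
    (fun y : U => (σ.current (Function.update e n (mv y)) (n + 1) : Set X)) fun y => Opens.isOpen _
  refine ⟨mv '' T, hT.image _, by rintro _ ⟨y, -, rfl⟩; rfl, fun x hx => ?_⟩
  have hmem : x ∈ ⋃ y : U, (σ.current (Function.update e n (mv y)) (n + 1) : Set X) := by
    refine mem_iUnion.2 ⟨⟨x, hx⟩, ?_⟩
    have := ((h.update (m := mv ⟨x, hx⟩) hU).legalReply n n.lt_succ_self).1
    simpa [mv, current] using this
  rw [← hTU] at hmem
  obtain ⟨y, hy, hxy⟩ := mem_iUnion₂.1 hmem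
  exact ⟨mv y, mem_image_of_mem _ hy, hxy⟩

/-- A countable tree of positions of the game in which Nonempty follows `σ`. A position consists of
a sequence of moves of Empty and of the number of its terms that have been played. -/
theorem exists_countable_tree [SecondCountableTopology X] (σ : Strategy X) (m₀ : EmptyMove X)
    (B : ℕ → Opens X) :
    ∃ T : Set ((ℕ → EmptyMove X) × ℕ), T.Countable ∧ (Function.const ℕ m₀, 0) ∈ T ∧
      (∀ p ∈ T, σ.LegalUpTo p.1 p.2) ∧
      ∀ p ∈ T, ∀ k, ∀ x ∈ σ.current p.1 p.2 ⊓ B k, ∃ m : EmptyMove X,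
        m.nbhd = σ.current p.1 p.2 ⊓ B k ∧ (Function.update p.1 p.2 m, p.2 + 1) ∈ T ∧
        x ∈ σ.current (Function.update p.1 p.2 m) (p.2 + 1) := by
  have hM : ∀ (p : (ℕ → EmptyMove X) × ℕ) (k : ℕ), ∃ M : Set (EmptyMove X), M.Countable ∧
      (∀ m ∈ M, m.nbhd = σ.current p.1 p.2 ⊓ B k) ∧ (σ.LegalUpTo p.1 p.2 →
        ∀ x ∈ σ.current p.1 p.2 ⊓ B k, ∃ m ∈ M,
          x ∈ σ.current (Function.update p.1 p.2 m) (p.2 + 1)) := by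
    intro p k
    by_cases hp : σ.LegalUpTo p.1 p.2
    · obtain ⟨M, h1, h2, h3⟩ := hp.exists_countable_moves (U := σ.current p.1 p.2 ⊓ B k) inf_le_left
      exact ⟨M, h1, h2, fun _ => h3⟩
    · exact ⟨∅, countable_empty, by simp, fun h => absurd h hp⟩
  choose M hMc hMn hMx using hM
  let T : ℕ → Set ((ℕ → EmptyMove X) × ℕ) := fun n => Nat.rec {(Function.const ℕ m₀, 0)}
    (fun _ S => ⋃ p ∈ S, ⋃ k, (fun m => (Function.update p.1 p.2 m, p.2 + 1)) '' M p k) n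
  have hTsucc : ∀ n, T (n + 1) =
      ⋃ p ∈ T n, ⋃ k, (fun m => (Function.update p.1 p.2 m, p.2 + 1)) '' M p k := fun _ => rfl
  have hTc : ∀ n, (T n).Countable := by
    intro n
    induction n with
    | zero => exact countable_singleton _
    | succ n ih =>
      rw [hTsucc]
      exact ih.biUnion fun p _ => countable_iUnion fun k => (hMc p k).image _
  have hTl : ∀ n, ∀ p ∈ T n, σ.LegalUpTo p.1 p.2 := by
    intro n
    induction n with
    | zero =>
      rintro p rfl i hi
      exact absurd hi (Nat.not_lt_zero i)
    | succ n ih =>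
      intro q hq
      rw [hTsucc] at hq
      simp only [mem_iUnion, mem_image] at hq
      obtain ⟨p, hp, k, m, hm, rfl⟩ := hq
      exact (ih p hp).update ((hMn p k m hm).trans_le inf_le_left)
  refine ⟨⋃ n, T n, countable_iUnion hTc, mem_iUnion.2 ⟨0, rfl⟩, fun p hp => ?_,
    fun p hp k x hx => ?_⟩
  · obtain ⟨n, hn⟩ := mem_iUnion.1 hp
    exact hTl n p hn
  · obtain ⟨n, hn⟩ := mem_iUnion.1 hp
    obtain ⟨m, hm, hxm⟩ := hMx p k (hTl n p hn) x hx
    refine ⟨m, hMn p k m hm, mem_iUnion.2 ⟨n + 1, ?_⟩, hxm⟩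
    rw [hTsucc]
    simp only [mem_iUnion, mem_image]
    exact ⟨p, hn, k, m, hm, rfl⟩

/-- A play built by extending positions one move at a time. -/
theorem exists_play_of_positions (σ : Strategy X) (m : ℕ → EmptyMove X)
    (p : ℕ → (ℕ → EmptyMove X) × ℕ) (h0 : (p 0).2 = 0)
    (hsucc : ∀ i, p (i + 1) = (Function.update (p i).1 (p i).2 (m i), (p i).2 + 1))
    (hlegal : ∀ i, σ.LegalUpTo (p i).1 (p i).2) :
    IsPlay m (σ.run m) ∧ ∀ i, σ.current m i = σ.current (p i).1 i := by
  have hlen : ∀ i, (p i).2 = i := by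
    intro i
    induction i with
    | zero => exact h0
    | succ i ih => rw [hsucc, ih]
  have hagree : ∀ i, ∀ j < i, m j = (p i).1 j := by
    intro i
    induction i with
    | zero => exact fun j hj => absurd hj (Nat.not_lt_zero j)
    | succ i ih =>
      intro j hj
      rw [hsucc, hlen]
      rcases (Nat.lt_succ_iff.1 hj).eq_or_lt with rfl | hlt
      · simp
      · simp only [Function.update_of_ne hlt.ne]
        exact ih j hlt
  have hcur : ∀ i, ∀ j ≤ i, σ.current m j = σ.current (p i).1 j := fun i j hj =>
    σ.current_congr fun l hl => hagree i l (hl.trans_le hj)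
  refine ⟨isPlay_run fun n i hi => ?_, fun i => hcur i i le_rfl⟩
  have := hlegal n i (by rwa [hlen])
  rwa [hcur n i hi.le, hagree n i hi]

end Strategy

theorem isQuasiPolish_of_convergent [T0Space X] [SecondCountableTopology X] (σ : Strategy X)
    (hσ : σ.IsConvergent) : IsQuasiPolish X := by
  obtain ⟨B, hB⟩ := exists_basis_sequence X
  have hBo : ∀ k, IsOpen (B k) := fun k => hB.isOpen (mem_range_self k)
  -- A point is needed as the filler move at the root of the tree.
  rcases isEmpty_or_nonempty X with hX | ⟨⟨x₀⟩⟩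
  · exact isQuasiPolish_of_levels (J := fun k => {k}) hB mem_range_self
      fun u _ => (hX.false (u 0)).elim
  obtain ⟨T, hTc, hT0, hTl, hTx⟩ :=
    σ.exists_countable_tree ⟨x₀, ⊤, trivial⟩ fun k => ⟨B k, hBo k⟩
  let child : (ℕ → EmptyMove X) × ℕ → EmptyMove X → (ℕ → EmptyMove X) × ℕ :=
    fun p m => (Function.update p.1 p.2 m, p.2 + 1)
  let V : (ℕ → EmptyMove X) × ℕ → Opens X := fun p => σ.current p.1 p.2
  -- The indices of basic sets lying inside one of the tree's answers to a move with open set `V p ∩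
  -- B k`; by `hTx` they cover `V p ∩ B k`.
  let J' : (ℕ → EmptyMove X) × ℕ → ℕ → Set ℕ := fun p k =>
    {j | ∃ m : EmptyMove X, m.nbhd = V p ⊓ ⟨B k, hBo k⟩ ∧ child p m ∈ T ∧
      B j ⊆ V (child p m)}
  obtain ⟨J, hJ⟩ : ∃ J : ℕ → Set ℕ,
      insert univ (range (fun k : ℕ => ({k} : Set ℕ)) ∪ ⋃ p ∈ T, range (J' p)) = range J :=
    (((countable_range _).union
      (hTc.biUnion fun p _ => countable_range (J' p))).insert univ).exists_eq_range
        (insert_nonempty _ _)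
  refine isQuasiPolish_of_levels (J := J) hB
    (fun k => hJ ▸ Or.inr (Or.inl (mem_range_self k))) fun u hu => ?_
  -- Covering even one term after stabilization makes the limiting level finite; its value is the
  -- required index.
  have hlev : ∀ A ∈ range J, (∀ᶠ i in atTop, ∃ j ∈ A, u i ∈ B j) →
      ∃ j ∈ A, ∀ᶠ i in atTop, u i ∈ B j := by
    rintro _ ⟨n, rfl⟩ hA
    obtain ⟨l, hl⟩ := hu n
    obtain ⟨i, ⟨j, hj, hij⟩, hi⟩ := (hA.and hl).exists
    have hltop : l ≠ ⊤ := ((hi ▸ level_le hj hij).trans_lt (ENat.natCast_lt_top j)).ne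
    obtain ⟨a, rfl⟩ := ENat.ne_top_iff_exists.1 hltop
    exact ⟨a, (mem_of_level_eq hi).1, hl.mono fun i hi => (mem_of_level_eq hi).2⟩
  let S : Set ℕ := {k | ∀ᶠ i in atTop, u i ∈ B k}
  -- The index set `univ` was included to make `S` nonempty.
  obtain ⟨k₀, -, hk₀⟩ := hlev univ (hJ ▸ Or.inl rfl) <| Eventually.of_forall fun i => by
    obtain ⟨_, ⟨k, rfl⟩, hk, -⟩ := hB.exists_subset_of_mem_open (mem_univ (u i)) isOpen_univ
    exact ⟨k, mem_univ k, hk⟩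
  obtain ⟨f, hf⟩ := S.to_countable.exists_eq_range ⟨k₀, hk₀⟩
  -- Invariant of the play: the current open set contains almost all terms of `u`, as witnessed by a
  -- basic set.
  let Q := {p : (ℕ → EmptyMove X) × ℕ // p ∈ T ∧ ∃ j ∈ S, B j ⊆ V p}
  have hstep : ∀ (i : ℕ) (p : Q), ∃ m : EmptyMove X,
      m.nbhd = V p.1 ⊓ ⟨B (f i), hBo (f i)⟩ ∧ child p.1 m ∈ T ∧
        ∃ j ∈ S, B j ⊆ V (child p.1 m) := by
    rintro i ⟨p, hp, j, hj, hjV⟩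
    have hfi : f i ∈ S := hf ▸ mem_range_self i
    obtain ⟨a, ⟨m, hm, hmT, ha⟩, haS⟩ := hlev (J' p (f i))
      (hJ ▸ Or.inr (Or.inr (mem_iUnion₂.2 ⟨p, hp, mem_range_self _⟩))) <| by
        filter_upwards [hj, hfi] with l hl hl'
        obtain ⟨m, hm, hmT, hmx⟩ := hTx p hp (f i) (u l) ⟨hjV hl, hl'⟩
        obtain ⟨_, ⟨a, rfl⟩, ha, haV⟩ := hB.exists_subset_of_mem_open hmx (Opens.isOpen _)
        exact ⟨a, ⟨m, hm, hmT, haV⟩, ha⟩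
    exact ⟨m, hm, hmT, a, haS, ha⟩
  choose mv hmv hmvT hmvS using hstep
  let p : ℕ → Q := fun n => Nat.rec ⟨_, hT0, k₀, hk₀, fun _ _ => trivial⟩
    (fun i q => ⟨child q.1 (mv i q), hmvT i q, hmvS i q⟩) n
  have hpsucc : ∀ i, (p (i + 1)).1 = child (p i).1 (mv i (p i)) := fun _ => rfl
  obtain ⟨hplay, hcur⟩ := σ.exists_play_of_positions (fun i => mv i (p i)) (fun i => (p i).1)
    rfl hpsucc fun i => hTl _ (p i).2.1
  have hplen : ∀ i, (p i).1.2 = i := by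
    intro i
    induction i with
    | zero => rfl
    | succ i ih => rw [hpsucc]; exact congrArg (· + 1) ih
  obtain ⟨x, hx, hbasis⟩ := hσ _ _ hplay (σ.follows_run _)
  refine ⟨x, fun k => ⟨fun hk => ?_, fun hk => ?_⟩⟩
  -- Some answer lies inside `B k`, and by the invariant it contains almost all of `u`.
  · obtain ⟨i, -, hi⟩ := hbasis.mem_iff.1 ((hBo k).mem_nhds hk)
    obtain ⟨j, hj, hjV⟩ := (p (i + 1)).2.2
    have hV : V (p (i + 1)).1 = σ.run (fun i => mv i (p i)) i := by
      have := hcur (i + 1)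
      simp only [V, hplen]
      exact this.symm
    rw [hV] at hjV
    exact hj.mono fun l hl => hi (hjV hl)
  -- Empty's move in round `i` was contained in `B (f i)`.
  · obtain ⟨i, rfl⟩ : k ∈ range f := hf ▸ hk
    have hxi := (hplay i).1.2 (mem_iInter.1 hx i)
    rw [hmv] at hxi
    exact hxi.2

end ChoquetGame

theorem corollary3p11 (X : Type*) [TopologicalSpace X] [T0Space X] [SecondCountableTopology X] :
    List.TFAE [
      ∃ σ : ChoquetGame.Strategy X, σ.IsWinning ∧ σ.IsConvergent,
      ∃ σ : ChoquetGame.Strategy X, σ.IsWinning ∧ σ.IsConvergent ∧ σ.IsStationary,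
      IsQuasiPolish X] := by
  tfae_have 2 → 1 := fun ⟨σ, hw, hc, _⟩ => ⟨σ, hw, hc⟩
  tfae_have 1 → 3 := fun ⟨σ, _, hc⟩ => ChoquetGame.isQuasiPolish_of_convergent σ hc
  tfae_have 3 → 2 := fun ⟨_, d, hd, ht⟩ =>
    ChoquetGame.exists_stationary_convergent_of_complete d hd fun U => by rw [ht]; exact d.isOpen_iff
  tfae_finish
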